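/- Let $I$ be the category whose objects are the sets $\mathbf n=\{1,\dots,n\}$ for $n\ge 0$ (with $\mathbf 0=\emptyset$) and whose morphisms are all injective maps. Let $\mathbb N\subset I$ be the subcategory with all objects and only the inclusions as morphisms. Let $M$ be the monoid, under composition, of all injective self-maps of $\omega=\{1,2,3,\dots\}$, and let $\mathbb Z[M]$ be its monoid ring. For a functor $F$ from $I$ to abelian groups, the abelian group $\operatorname{colim}_{\mathbb N}F$ is a left $\mathbb Z[M]$-module, natural in $F$, as follows: if $f\in M$ and $[x]$ is the class of $x\in F(\mathbf n)$, then $f\cdot[x]=[(f|_{\mathbf n})_*(x)]$, where $f|_{\mathbf n}:\mathbf n\to\mathbf m$ is the restriction of $f$ to $\mathbf n$, for any $m$ with $f(\mathbf n)\subseteq\mathbf m$. Let $\operatorname{colim}^p_I$ denote the $p$-th left derived functor of the colimit functor $\operatorname{colim}_I$ from the category of functors $I\to\mathcal{A}b$ to the category $\mathcal{A}b$ of abelian groups, and let $\mathbb Z$ be the trivial right $\mathbb Z[M]$-module. Proposition. For every $p\ge 0$ there is an isomorphism of abelian groups $$\operatorname{colim}^p_I F\;\cong\;\operatorname{Tor}_p^{\mathbb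 Z[M]}(\mathbb Z,\operatorname{colim}_{\mathbb N}F)$$ that is natural in the functor $F:I\to\mathcal{A}b$. -/

import Mathlib

open CategoryTheory CategoryTheory.Limits

universe w u

noncomputable section

/-! ### Enough projectives

These facts make the left derived functors below available. -/

namespace DerivedColim

instance enoughProjectives_addCommGrpCat : EnoughProjectives AddCommGrpCat.{u} :=
  (Equivalence.enoughProjectives_iff
    (forget₂ (ModuleCat.{u} ℤ) AddCommGrpCat.{u}).asEquivalence).1 inferInstance

/-- Functors from a small category to abelian groups have enough projectives. -/
instance enoughProjectives_functor (J : Type) [SmallCategory J] :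
    EnoughProjectives (J ⥤ AddCommGrpCat.{u}) where
  presentation F := by
    let P : J → (J ⥤ AddCommGrpCat.{u}) := fun j =>
      (evaluationLeftAdjoint AddCommGrpCat.{u} j).obj (Projective.over (F.obj j))
    let e : ∀ j, P j ⟶ F := fun j =>
      ((evaluationAdjunctionRight AddCommGrpCat.{u} j).homEquiv _ _).symm
        (Projective.π (F.obj j))
    have hP : ∀ j, Projective (P j) := fun j =>
      (evaluationAdjunctionRight AddCommGrpCat.{u} j).map_projective _ inferInstance
    refine ⟨{ p := ∐ P, f := Sigma.desc e, projective := ?_, epi := ?_ }⟩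
    · exact ⟨fun f g _ => ⟨Sigma.desc fun j => (hP j).factors (Sigma.ι P j ≫ f) g |>.choose,
        Sigma.hom_ext _ _ fun j => by
          simpa using ((hP j).factors (Sigma.ι P j ≫ f) g).choose_spec⟩⟩
    rw [NatTrans.epi_iff_epi_app]
    intro j
    have h1 : (Sigma.ι P j ≫ Sigma.desc e) = e j := by simp
    have h2 : (evaluationAdjunctionRight AddCommGrpCat.{u} j).unit.app _ ≫ (e j).app j =
        Projective.π (F.obj j) := by
      have := ((evaluationAdjunctionRight AddCommGrpCat.{u} j).homEquiv
        (Projective.over (F.obj j)) F).apply_symm_apply (Projective.π (F.obj j))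
      rw [Adjunction.homEquiv_unit] at this
      exact this
    have h3 : ((evaluationAdjunctionRight AddCommGrpCat.{u} j).unit.app _ ≫
        (Sigma.ι P j).app j) ≫ (Sigma.desc e).app j = Projective.π (F.obj j) := by
      rw [← h2, ← h1, NatTrans.comp_app, Category.assoc]
    have : Epi (((evaluationAdjunctionRight AddCommGrpCat.{u} j).unit.app _ ≫
        (Sigma.ι P j).app j) ≫ (Sigma.desc e).app j) := by
      rw [h3]; infer_instance
    exact epi_of_epi ((evaluationAdjunctionRight AddCommGrpCat.{u} j).unit.app _ ≫
      (Sigma.ι P j).app j) _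

instance colim_additive (J : Type) [SmallCategory J] :
    (colim : (J ⥤ AddCommGrpCat.{u}) ⥤ AddCommGrpCat.{u}).Additive where
  map_add {F G f g} := colimit.hom_ext fun j => by simp

/-! ### Tensor products and Tor over a noncommutative ring -/

section Tor

open scoped TensorProduct

variable (R : Type) [Ring R] (N : Type w) [AddCommGroup N] [Module Rᵐᵒᵖ N]

/-- The relations `n r ⊗ v = n ⊗ r v` in `N ⊗_ℤ V`, for a right `R`-module `N` (that is, a module
over the opposite ring) and a left `R`-module `V`. -/
def balancedRel (V : Type u) [AddCommGroup V] [Module R V] : AddSubgroup (N ⊗[ℤ] V) :=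
  AddSubgroup.closure
    {x | ∃ (n : N) (r : R) (v : V), x = (MulOpposite.op r • n) ⊗ₜ[ℤ] v - n ⊗ₜ[ℤ] (r • v)}

/-- The abelian group `N ⊗_R V`. -/
abbrev BalancedTensor (V : Type u) [AddCommGroup V] [Module R V] : Type (max w u) :=
  (N ⊗[ℤ] V) ⧸ balancedRel R N V

/-- The homomorphism `N ⊗_R V → N ⊗_R W` induced by an `R`-linear map `V → W`. -/
def BalancedTensor.map {V W : Type u} [AddCommGroup V] [Module R V] [AddCommGroup W] [Module R W]
    (f : V →ₗ[R] W) : BalancedTensor R N V →+ BalancedTensor R N W :=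
  QuotientAddGroup.map _ _
    (TensorProduct.map LinearMap.id f.toAddMonoidHom.toIntLinearMap).toAddMonoidHom <| by
      rw [balancedRel, AddSubgroup.closure_le]
      rintro _ ⟨n, r, v, rfl⟩
      refine AddSubgroup.subset_closure ⟨n, r, f v, ?_⟩
      simp

variable {R N} in
lemma BalancedTensor.hom_ext {V : Type u} [AddCommGroup V] [Module R V] {A : Type*}
    [AddCommGroup A] {f g : BalancedTensor R N V →+ A}
    (h : ∀ (n : N) (v : V), f (QuotientAddGroup.mk (n ⊗ₜ[ℤ] v)) =
      g (QuotientAddGroup.mk (n ⊗ₜ[ℤ] v))) : f = g := by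
  refine QuotientAddGroup.addMonoidHom_ext _ (AddMonoidHom.ext fun x => ?_)
  induction x using TensorProduct.induction_on with
  | zero => rw [map_zero, map_zero]
  | tmul n v => exact h n v
  | add x y hx hy => rw [map_add, map_add, hx, hy]

/-- The functor `N ⊗_R -` from left `R`-modules to abelian groups. -/
def tensorFunctor : ModuleCat.{u} R ⥤ AddCommGrpCat.{max w u} where
  obj V := AddCommGrpCat.of (BalancedTensor R N V)
  map f := AddCommGrpCat.ofHom (BalancedTensor.map R N f.hom)
  map_id _ := AddCommGrpCat.hom_ext (BalancedTensor.hom_ext fun _ _ => rfl)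
  map_comp _ _ := AddCommGrpCat.hom_ext (BalancedTensor.hom_ext fun _ _ => rfl)

instance : (tensorFunctor.{w, u} R N).Additive where
  map_add {_ W f g} := AddCommGrpCat.hom_ext (BalancedTensor.hom_ext fun n v =>
    congrArg (QuotientAddGroup.mk (s := balancedRel R N W))
      (TensorProduct.tmul_add n (f.hom v) (g.hom v)))

/-- `Tor_p^R(N, -)`, the `p`-th left derived functor of `N ⊗_R -`. -/
def torFunctor (p : ℕ) : ModuleCat.{u} R ⥤ AddCommGrpCat.{max w u} :=
  (tensorFunctor.{w, u} R N).leftDerived p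

end Tor

/-! ### The category `I` and the monoid `M` -/

/-- The category `I`: its objects are the sets `𝐧` with `n` elements, for `n : ℕ`, and its
morphisms are all injective maps. We use `Fin n = {0, …, n - 1}` for `𝐧`. -/
structure I : Type where
  /-- The number of elements. -/
  card : ℕ

instance : SmallCategory I where
  Hom n m := Fin n.card ↪ Fin m.card
  id n := Function.Embedding.refl _
  comp f g := f.trans g

/-- The functor `ℕ ⥤ I` whose image is the subcategory of all objects and the inclusions. -/
abbrev inclusion : ℕ ⥤ I where
  obj n := ⟨n⟩
  map {n m} h := (Fin.castLEEmb (leOfHom h) : Fin n ↪ Fin m)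

/-- The monoid `M` of injective self-maps of the countable set `ω = {0, 1, 2, …}` under
composition. -/
def M : Submonoid (Function.End ℕ) where
  carrier := {f | Function.Injective f}
  one_mem' := Function.injective_id
  mul_mem' hf hg := Function.Injective.comp hf hg

lemma M_mul_apply (f g : M) (i : ℕ) : (f * g).1 i = f.1 (g.1 i) := rfl

/-- The monoid ring `ℤ[M]`. -/
abbrev ZM : Type := MonoidAlgebra ℤ M

/-- The group of integers, as the trivial right `ℤ[M]`-module. -/
def TrivialInt : Type := ℤ

instance : AddCommGroup TrivialInt := inferInstanceAs (AddCommGroup ℤ)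

/-- The augmentation `ℤ[M] → ℤ`, which sends every element of `M` to `1`. -/
def augmentation : ZM →+* ℤ := (MonoidAlgebra.lift ℤ ℤ M (1 : M →* ℤ)).toRingHom

instance : Module ZMᵐᵒᵖ TrivialInt :=
  Module.compHom ℤ (augmentation.fromOpposite fun _ _ => Commute.all _ _)

lemma op_of_smul_trivialInt (f : M) (z : TrivialInt) :
    MulOpposite.op (MonoidAlgebra.of ℤ M f) • z = z := by
  change (augmentation (MonoidAlgebra.of ℤ M f) * id (α := ℤ) z : ℤ) = id (α := ℤ) z
  simp [augmentation]

/-! ### The `M`-module `colim_ℕ F` -/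

/-- The restriction of `f : ω → ω` to an injection `𝐧 → 𝐦`, if `f` maps `𝐧` into `𝐦`. -/
def restrict (f : M) {n m : ℕ} (h : ∀ i < n, f.1 i < m) : (⟨n⟩ : I) ⟶ ⟨m⟩ :=
  (⟨fun i => ⟨f.1 i, h i i.2⟩, fun i j hij => Fin.ext (f.2 (congrArg Fin.val hij))⟩ :
    Fin n ↪ Fin m)

/-- The smallest `m` such that `f` maps `𝐧` into `𝐦`. -/
def bound (f : M) (n : ℕ) : ℕ := (Finset.range n).sup fun i => f.1 i + 1

lemma lt_bound (f : M) (n : ℕ) : ∀ i < n, f.1 i < bound f n := fun i hi =>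
  Finset.le_sup (f := fun i => f.1 i + 1) (Finset.mem_range.2 hi)

variable (F : I ⥤ AddCommGrpCat.{u})

/-- The abelian group `F(ω) = colim_ℕ F`. -/
abbrev omegaColim : AddCommGrpCat.{u} := colimit (inclusion ⋙ F)

/-- The canonical map `F(𝐧) → F(ω)`, `x ↦ [x]`. -/
abbrev omegaι (n : ℕ) : F.obj ⟨n⟩ ⟶ omegaColim F := colimit.ι (inclusion ⋙ F) n

/-- The map `F(𝐧) → F(ω)`, `x ↦ [(f|_𝐧)_* x]`. -/
def omegaLeg (f : M) (n : ℕ) : F.obj ⟨n⟩ ⟶ omegaColim F :=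
  F.map (restrict f (lt_bound f n)) ≫ omegaι F (bound f n)

lemma map_inclusion_ι {n m : ℕ} (h : n ≤ m) :
    F.map (inclusion.map (homOfLE h)) ≫ omegaι F m = omegaι F n :=
  colimit.w (inclusion ⋙ F) (homOfLE h)

/-- The class `[(f|_𝐧)_* x]` does not depend on the choice of a `𝐦` that contains `f(𝐧)`. -/
lemma omegaLeg_eq (f : M) {n m : ℕ} (h : ∀ i < n, f.1 i < m) :
    omegaLeg F f n = F.map (restrict f h) ≫ omegaι F m := by
  have hm : bound f n ≤ m := Finset.sup_le fun i hi => h i (Finset.mem_range.1 hi)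
  have : restrict f h = restrict f (lt_bound f n) ≫ inclusion.map (homOfLE hm) := rfl
  rw [this, F.map_comp, Category.assoc]
  exact congrArg (F.map (restrict f (lt_bound f n)) ≫ ·) (map_inclusion_ι F hm).symm

/-- The action `f_* : F(ω) → F(ω)` of `f ∈ M`, given by `f_*[x] = [(f|_𝐧)_* x]`. -/
def omegaMap (f : M) : omegaColim F ⟶ omegaColim F :=
  colimit.desc (inclusion ⋙ F)
    { pt := omegaColim F
      ι :=
        { app := fun n => omegaLeg F f n
          naturality := fun n m g => by
            have hn : ∀ i < n, f.1 i < bound f m := fun i hi =>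
              lt_bound f m i (lt_of_lt_of_le hi (leOfHom g))
            change F.map (inclusion.map g) ≫ omegaLeg F f m = omegaLeg F f n ≫ 𝟙 _
            rw [Category.comp_id, omegaLeg_eq F f hn]
            exact (F.map_comp_assoc (inclusion.map g) (restrict f (lt_bound f m)) _).symm } }

lemma ι_omegaMap (f : M) {n m : ℕ} (h : ∀ i < n, f.1 i < m) :
    omegaι F n ≫ omegaMap F f = F.map (restrict f h) ≫ omegaι F m := by
  rw [← omegaLeg_eq]
  exact colimit.ι_desc _ _

lemma ι_omegaMap_assoc (f : M) {n m : ℕ} (h : ∀ i < n, f.1 i < m) {A : AddCommGrpCat.{u}}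
    (g : omegaColim F ⟶ A) :
    omegaι F n ≫ omegaMap F f ≫ g = F.map (restrict f h) ≫ omegaι F m ≫ g := by
  rw [← Category.assoc, ι_omegaMap F f h, Category.assoc]

/-- The action of `M` on `F(ω)`. It is a left action: the product of two endomorphisms `a * b` is
`b` followed by `a`. -/
def omegaAction : M →* End (omegaColim F) where
  toFun f := omegaMap F f
  map_one' := colimit.hom_ext fun n => by
    have h : ∀ i < n, (1 : M).1 i < n := fun i hi => hi
    have h' : restrict 1 h = 𝟙 _ := rfl
    refine (ι_omegaMap F 1 h).trans ?_
    rw [h', F.map_id, Category.id_comp]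
    exact (Category.comp_id _).symm
  map_mul' f g := colimit.hom_ext fun n => by
    have hg := lt_bound g n
    have hf := lt_bound f (bound g n)
    have hfg : ∀ i < n, (f * g).1 i < bound f (bound g n) := fun i hi => hf _ (hg i hi)
    refine (ι_omegaMap F (f * g) hfg).trans ?_
    change _ = omegaι F n ≫ omegaMap F g ≫ omegaMap F f
    rw [ι_omegaMap_assoc F g hg, ι_omegaMap F f hf, ← Category.assoc, ← F.map_comp]
    rfl

variable {F} in
lemma omegaMap_naturality {G : I ⥤ AddCommGrpCat.{u}} (φ : F ⟶ G) (f : M) :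
    colimMap (Functor.whiskerLeft inclusion φ) ≫ omegaMap G f =
      omegaMap F f ≫ colimMap (Functor.whiskerLeft inclusion φ) := by
  refine colimit.hom_ext fun n => ?_
  have h := lt_bound f n
  have hι (k : ℕ) : omegaι F k ≫ colimMap (Functor.whiskerLeft inclusion φ) =
      φ.app ⟨k⟩ ≫ omegaι G k := ι_colimMap _ _
  calc omegaι F n ≫ colimMap (Functor.whiskerLeft inclusion φ) ≫ omegaMap G f
      = φ.app ⟨n⟩ ≫ omegaι G n ≫ omegaMap G f := by rw [reassoc_of% hι]
    _ = φ.app ⟨n⟩ ≫ G.map (restrict f h) ≫ omegaι G (bound f n) := by rw [ι_omegaMap G f h]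
    _ = F.map (restrict f h) ≫ φ.app ⟨bound f n⟩ ≫ omegaι G (bound f n) := by
      rw [φ.naturality_assoc]
    _ = omegaι F n ≫ omegaMap F f ≫ colimMap (Functor.whiskerLeft inclusion φ) := by
      rw [ι_omegaMap_assoc F f h, hι]

/-- The ring homomorphism `ℤ[M] → End(F(ω))` that extends the action of `M` additively. -/
def omegaRingHom : ZM →+* End (omegaColim F) :=
  (MonoidAlgebra.lift ℤ (End (omegaColim F)) M (omegaAction F)).toRingHom

/-- The left `ℤ[M]`-module `colim_ℕ F`. -/
def colimModule : ModuleCat.{u} ZM := ModuleCat.mkOfSMul (omegaRingHom F)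

variable {F} in
lemma omegaRingHom_naturality {G : I ⥤ AddCommGrpCat.{u}} (φ : F ⟶ G) (r : ZM) :
    colimMap (Functor.whiskerLeft inclusion φ) ≫ omegaRingHom G r =
      omegaRingHom F r ≫ colimMap (Functor.whiskerLeft inclusion φ) := by
  induction r using MonoidAlgebra.induction_on with
  | of f =>
    have hF (H : I ⥤ AddCommGrpCat.{u}) :
        omegaRingHom H (MonoidAlgebra.of ℤ M f) = omegaMap H f := by
      simp [omegaRingHom, omegaAction]
    rw [hF, hF]
    exact omegaMap_naturality φ f
  | add a b ha hb =>
    rw [map_add, map_add]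
    exact (Preadditive.comp_add ..).trans
      ((congrArg₂ (· + ·) ha hb).trans (Preadditive.add_comp ..).symm)
  | smul k a ha =>
    rw [map_zsmul, map_zsmul]
    exact (Preadditive.comp_zsmul ..).trans
      ((congrArg (k • ·) ha).trans (Preadditive.zsmul_comp ..).symm)

/-- The functor `F ↦ colim_ℕ F` from `I`-functors to left `ℤ[M]`-modules. -/
def colimNat : (I ⥤ AddCommGrpCat.{u}) ⥤ ModuleCat.{u} ZM where
  obj F := colimModule F
  map {F G} φ := ModuleCat.homMk (M := colimModule F) (N := colimModule G)
    (colimMap (Functor.whiskerLeft inclusion φ)) (omegaRingHom_naturality φ)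
  map_id F := (forget₂ (ModuleCat.{u} ZM) AddCommGrpCat.{u}).map_injective <| by
    refine (colimit.hom_ext fun n => ?_ :
      colimMap (Functor.whiskerLeft inclusion (𝟙 F)) = 𝟙 (omegaColim F))
    simp
  map_comp {F G H} φ ψ := (forget₂ (ModuleCat.{u} ZM) AddCommGrpCat.{u}).map_injective <| by
    refine (colimit.hom_ext fun n => ?_ :
      colimMap (Functor.whiskerLeft inclusion (φ ≫ ψ)) =
        colimMap (Functor.whiskerLeft inclusion φ) ≫ colimMap (Functor.whiskerLeft inclusion ψ))
    simp

end DerivedColim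

end

noncomputable section

namespace DerivedColim

/-! ### Comparison of a projective resolution with an exact augmented complex -/

section Comparison

variable {𝒜 : Type*} [Category 𝒜] [Abelian 𝒜]

/-- The augmented complex `⋯ ⟶ L₁ ⟶ L₀ ⟶ Y ⟶ 0` is exact. -/
structure IsResolution (L : ChainComplex 𝒜 ℕ) {Y : 𝒜} (ε : L.X 0 ⟶ Y) : Prop where
  w : L.d 1 0 ≫ ε = 0
  epi : Epi ε
  exact_zero : (ShortComplex.mk _ _ w).Exact
  exact_succ (n : ℕ) : (ShortComplex.mk _ _ (L.d_comp_d (n + 2) (n + 1) n)).Exact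

/-- The augmentation `P₀ ⟶ Y` of a projective resolution of `Y`. -/
def resolutionAug {Y : 𝒜} (P : ProjectiveResolution Y) : P.complex.X 0 ⟶ Y := P.π.f 0

lemma isResolution_of_projectiveResolution {Y : 𝒜} (P : ProjectiveResolution Y) :
    IsResolution P.complex (resolutionAug P) where
  w := P.complex_d_comp_π_f_zero
  epi := inferInstanceAs (Epi (P.π.f 0))
  exact_zero := P.exact₀
  exact_succ := P.exact_succ

lemma IsResolution.map {ℬ : Type*} [Category ℬ] [Abelian ℬ] (U : 𝒜 ⥤ ℬ) [U.Additive]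
    [U.PreservesHomology] [U.PreservesEpimorphisms] {L : ChainComplex 𝒜 ℕ} {Y : 𝒜}
    {ε : L.X 0 ⟶ Y} (h : IsResolution L ε) :
    IsResolution ((U.mapHomologicalComplex _).obj L) (U.map ε) where
  w := by
    have := congrArg U.map h.w
    rwa [U.map_comp, U.map_zero] at this
  epi := have := h.epi; U.map_epi ε
  exact_zero := h.exact_zero.map U
  exact_succ n := (h.exact_succ n).map U

variable {X Y : 𝒜} (P : ProjectiveResolution X) {L : ChainComplex 𝒜 ℕ} {ε : L.X 0 ⟶ Y}

lemma IsResolution.exists_lift (h : IsResolution L ε) (f : X ⟶ Y) :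
    ∃ φ : P.complex ⟶ L, φ.f 0 ≫ ε = resolutionAug P ≫ f := by
  have := h.epi
  let φ₀ : P.complex.X 0 ⟶ L.X 0 := Projective.factorThru (resolutionAug P ≫ f) ε
  have h₀ : φ₀ ≫ ε = resolutionAug P ≫ f := Projective.factorThru_comp _ _
  have hw : (P.complex.d 1 0 ≫ φ₀) ≫ ε = 0 := by
    rw [Category.assoc, h₀, ← Category.assoc, (isResolution_of_projectiveResolution P).w, zero_comp]
  let φ₁ : P.complex.X 1 ⟶ L.X 1 := h.exact_zero.liftFromProjective (P.complex.d 1 0 ≫ φ₀) hw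
  have h₁ : φ₁ ≫ L.d 1 0 = P.complex.d 1 0 ≫ φ₀ := h.exact_zero.liftFromProjective_comp _ _
  refine ⟨ChainComplex.mkHom _ _ φ₀ φ₁ h₁ fun n q =>
    ⟨(h.exact_succ n).liftFromProjective (P.complex.d (n + 2) (n + 1) ≫ q.2.1) ?_,
      (h.exact_succ n).liftFromProjective_comp _ _⟩, ?_⟩
  · change (_ ≫ _) ≫ L.d _ _ = 0
    rw [Category.assoc, q.2.2, ← Category.assoc, P.complex.d_comp_d, zero_comp]
  · exact h₀

lemma IsResolution.nonempty_homotopy_zero (h : IsResolution L ε) (φ : P.complex ⟶ L)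
    (hφ : φ.f 0 ≫ ε = 0) : Nonempty (Homotopy φ 0) := by
  let z₀ : P.complex.X 0 ⟶ L.X 1 := h.exact_zero.liftFromProjective (φ.f 0) hφ
  have h₀ : z₀ ≫ L.d 1 0 = φ.f 0 := h.exact_zero.liftFromProjective_comp _ _
  have hw : (φ.f 1 - P.complex.d 1 0 ≫ z₀) ≫ L.d 1 0 = 0 := by
    rw [Preadditive.sub_comp, Category.assoc, HomologicalComplex.Hom.comm, h₀, sub_self]
  let z₁ : P.complex.X 1 ⟶ L.X 2 := (h.exact_succ 0).liftFromProjective _ hw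
  have h₁ : z₁ ≫ L.d 2 1 = φ.f 1 - P.complex.d 1 0 ≫ z₀ :=
    (h.exact_succ 0).liftFromProjective_comp _ _
  refine ⟨Homotopy.mkInductive _ z₀ h₀.symm z₁ (by rw [h₁]; abel) fun n q =>
    ⟨(h.exact_succ (n + 1)).liftFromProjective (φ.f (n + 2) - P.complex.d _ _ ≫ q.2.1) ?_, ?_⟩⟩
  · have := q.2.2
    simp [this]
  · have := (h.exact_succ (n + 1)).liftFromProjective_comp
      (φ.f (n + 2) - P.complex.d (n + 2) (n + 1) ≫ q.2.1) (by have := q.2.2; simp [this])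
    dsimp only at this ⊢
    rw [this]
    abel

lemma IsResolution.nonempty_homotopy (h : IsResolution L ε) (φ ψ : P.complex ⟶ L)
    (hφ : φ.f 0 ≫ ε = ψ.f 0 ≫ ε) : Nonempty (Homotopy φ ψ) :=
  (h.nonempty_homotopy_zero P (φ - ψ) (by
    rw [HomologicalComplex.sub_f_apply, Preadditive.sub_comp, hφ, sub_self])).map
      Homotopy.equivSubZero.symm

end Comparison

/-! ### Derived functors linked by exact functors -/

section Linked

variable {𝒜 ℬ 𝒟 : Type*} [Category 𝒜] [Abelian 𝒜] [Category ℬ] [Abelian ℬ] [Category 𝒟]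
  [Abelian 𝒟]

/-- The chain map `T E P ⟶ C P` given by a natural transformation `E ⋙ T ⟶ C`. -/
def compChainMap {E : 𝒜 ⥤ ℬ} {T : ℬ ⥤ 𝒟} {C : 𝒜 ⥤ 𝒟} [E.Additive] [T.Additive] [C.Additive]
    (κ : E ⋙ T ⟶ C) (P : ChainComplex 𝒜 ℕ) :
    (T.mapHomologicalComplex _).obj ((E.mapHomologicalComplex _).obj P) ⟶
      (C.mapHomologicalComplex _).obj P where
  f i := κ.app (P.X i)
  comm' i j _ := (κ.naturality (P.d i j)).symm

lemma compChainMap_naturality {E : 𝒜 ⥤ ℬ} {T : ℬ ⥤ 𝒟} {C : 𝒜 ⥤ 𝒟} [E.Additive] [T.Additive]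
    [C.Additive] (κ : E ⋙ T ⟶ C) {P P' : ChainComplex 𝒜 ℕ} (φ : P ⟶ P') :
    (T.mapHomologicalComplex _).map ((E.mapHomologicalComplex _).map φ) ≫ compChainMap κ P' =
      compChainMap κ P ≫ (C.mapHomologicalComplex _).map φ :=
  HomologicalComplex.hom_ext _ _ fun i => κ.naturality (φ.f i)

/-- The chain map `P ⟶ S E P` given by a natural transformation `𝟭 ⟶ E ⋙ S`. -/
def unitCompChainMap {E : 𝒜 ⥤ ℬ} {S : ℬ ⥤ 𝒜} [E.Additive] [S.Additive] (θ : 𝟭 𝒜 ⟶ E ⋙ S)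
    (P : ChainComplex 𝒜 ℕ) :
    P ⟶ (S.mapHomologicalComplex _).obj ((E.mapHomologicalComplex _).obj P) where
  f i := θ.app (P.X i)
  comm' i j _ := (θ.naturality (P.d i j)).symm

/-- The chain map `P ⟶ R P` given by a natural transformation `𝟭 ⟶ R`. -/
def unitChainMap {R : 𝒜 ⥤ 𝒜} [R.Additive] (t : 𝟭 𝒜 ⟶ R) (P : ChainComplex 𝒜 ℕ) :
    P ⟶ (R.mapHomologicalComplex _).obj P where
  f i := t.app (P.X i)
  comm' i j _ := (t.naturality (P.d i j)).symm

variable [HasProjectiveResolutions 𝒜] [HasProjectiveResolutions ℬ]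

/-- If `C : 𝒜 ⥤ 𝒟` and `T : ℬ ⥤ 𝒟` are linked by exact functors `E : 𝒜 ⥤ ℬ` and `S : ℬ ⥤ 𝒜`
that are inverse to each other up to natural transformations, and these become identities after
`C` and `T` are applied, then `E` identifies the left derived functors of `C` with those of `T`. -/
theorem nonempty_leftDerived_iso {C : 𝒜 ⥤ 𝒟} {T : ℬ ⥤ 𝒟} {E : 𝒜 ⥤ ℬ} {S : ℬ ⥤ 𝒜} {R : ℬ ⥤ ℬ}
    [C.Additive] [T.Additive] [E.Additive] [S.Additive] [R.Additive]
    [E.PreservesHomology] [E.PreservesEpimorphisms]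
    [S.PreservesHomology] [S.PreservesEpimorphisms]
    [R.PreservesHomology] [R.PreservesEpimorphisms]
    (θ : 𝟭 𝒜 ⟶ E ⋙ S) (t : 𝟭 ℬ ⟶ R) (σ : S ⋙ E ⟶ R) (κ : E ⋙ T ⟶ C) (s : S ⋙ C ⟶ T)
    (ρ : R ⋙ T ⟶ T)
    (hC : ∀ F, C.map (θ.app F) ≫ s.app (E.obj F) ≫ κ.app F = 𝟙 _)
    (hT : ∀ V, T.map (t.app V) ≫ ρ.app V = 𝟙 _)
    (hE : ∀ F, E.map (θ.app F) ≫ σ.app (E.obj F) = t.app (E.obj F))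
    (hS : ∀ V, κ.app (S.obj V) ≫ s.app V = T.map (σ.app V) ≫ ρ.app V) (p : ℕ) :
    Nonempty (C.leftDerived p ≅ E ⋙ T.leftDerived p) := by
  let P (F : 𝒜) := projectiveResolution F
  let Q (F : 𝒜) := projectiveResolution (E.obj F)
  have hP (F : 𝒜) := isResolution_of_projectiveResolution (P F)
  have hQ (F : 𝒜) := isResolution_of_projectiveResolution (Q F)
  choose α hα using fun F => ((hP F).map E).exists_lift (Q F) (𝟙 _)
  choose β hβ using fun F => ((hQ F).map S).exists_lift (P F) (θ.app F)
  let ε (F : 𝒜) : (P F).complex.X 0 ⟶ F := resolutionAug (P F)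
  let ε' (F : 𝒜) : (Q F).complex.X 0 ⟶ E.obj F := resolutionAug (Q F)
  let α₀ (F : 𝒜) : (Q F).complex.X 0 ⟶ E.obj ((P F).complex.X 0) := (α F).f 0
  let β₀ (F : 𝒜) : (P F).complex.X 0 ⟶ S.obj ((Q F).complex.X 0) := (β F).f 0
  have hα₀ (F : 𝒜) : α₀ F ≫ E.map (ε F) = ε' F := (hα F).trans (Category.comp_id _)
  have hβ₀ (F : 𝒜) : β₀ F ≫ S.map (ε' F) = ε F ≫ θ.app F := hβ F
  let a (F : 𝒜) := (T.mapHomologicalComplex _).map (α F) ≫ compChainMap κ (P F).complex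
  let b (F : 𝒜) := (C.mapHomologicalComplex _).map (β F) ≫ compChainMap s (Q F).complex
  have hba (F : 𝒜) : Nonempty (Homotopy (b F ≫ a F) (𝟙 _)) := by
    obtain ⟨h⟩ := (((hP F).map E).map S).nonempty_homotopy (P F)
      (β F ≫ (S.mapHomologicalComplex _).map (α F)) (unitCompChainMap θ _) (by
        have h₁ : β₀ F ≫ S.map (α₀ F) ≫ S.map (E.map (ε F)) = ε F ≫ θ.app F := by
          rw [← S.map_comp, hα₀, hβ₀]
        exact (Category.assoc _ _ _).trans (h₁.trans (θ.naturality (ε F))))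
    have h₁ : b F ≫ a F = (C.mapHomologicalComplex _).map
        (β F ≫ (S.mapHomologicalComplex _).map (α F)) ≫ compChainMap s _ ≫ compChainMap κ _ := by
      rw [Functor.map_comp, Category.assoc, Category.assoc,
        reassoc_of% (compChainMap_naturality s (α F))]
    have h₂ : (C.mapHomologicalComplex _).map (unitCompChainMap θ (P F).complex) ≫
        compChainMap s _ ≫ compChainMap κ _ = 𝟙 _ :=
      HomologicalComplex.hom_ext _ _ fun i => hC _
    rw [h₁, ← h₂]
    exact ⟨(C.mapHomotopy h).compRight _⟩
  have hab (F : 𝒜) : Nonempty (Homotopy (a F ≫ b F) (𝟙 _)) := by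
    obtain ⟨h⟩ := ((hQ F).map R).nonempty_homotopy (Q F)
      (α F ≫ (E.mapHomologicalComplex _).map (β F) ≫ compChainMap σ _) (unitChainMap t _) (by
        have h₁ : (α₀ F ≫ E.map (β₀ F) ≫ σ.app ((Q F).complex.X 0)) ≫ R.map (ε' F) =
            ε' F ≫ t.app (E.obj F) := by
          have h₂ := σ.naturality (ε' F)
          dsimp only [Functor.comp_map] at h₂
          rw [Category.assoc, Category.assoc, ← h₂, ← E.map_comp_assoc, hβ₀, E.map_comp,
            Category.assoc, hE, reassoc_of% (hα₀ F)]
        exact h₁.trans (t.naturality (ε' F)))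
    have h₁ : a F ≫ b F = (T.mapHomologicalComplex _).map
        (α F ≫ (E.mapHomologicalComplex _).map (β F) ≫ compChainMap σ _) ≫ compChainMap ρ _ := by
      have h₃ : compChainMap κ _ ≫ compChainMap s (Q F).complex =
          (T.mapHomologicalComplex _).map (compChainMap σ _) ≫ compChainMap ρ _ :=
        HomologicalComplex.hom_ext _ _ fun i => hS _
      rw [Functor.map_comp, Functor.map_comp, Category.assoc, Category.assoc, Category.assoc,
        ← h₃, reassoc_of% (compChainMap_naturality κ (β F))]
    have h₂ : (T.mapHomologicalComplex _).map (unitChainMap t (Q F).complex) ≫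
        compChainMap ρ _ = 𝟙 _ :=
      HomologicalComplex.hom_ext _ _ fun i => hT _
    rw [h₁, ← h₂]
    exact ⟨(T.mapHomotopy h).compRight _⟩
  have hnat {F G : 𝒜} (f : F ⟶ G) (φ : (P F).complex ⟶ (P G).complex)
      (hφ : φ.f 0 ≫ ε G = ε F ≫ f)
      (χ : (Q F).complex ⟶ (Q G).complex)
      (hχ : χ.f 0 ≫ ε' G = ε' F ≫ E.map f) :
      Nonempty (Homotopy ((C.mapHomologicalComplex _).map φ ≫ b G)
        (b F ≫ (T.mapHomologicalComplex _).map χ)) := by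
    obtain ⟨h⟩ := ((hQ G).map S).nonempty_homotopy (P F) (φ ≫ β G)
      (β F ≫ (S.mapHomologicalComplex _).map χ) (by
        have h₁ : (φ.f 0 ≫ β₀ G) ≫ S.map (ε' G) = (β₀ F ≫ S.map (χ.f 0)) ≫ S.map (ε' G) := by
          have h₂ := θ.naturality f
          dsimp only [Functor.comp_map, Functor.id_map] at h₂
          rw [Category.assoc, hβ₀, Category.assoc, ← S.map_comp, hχ, S.map_comp,
            reassoc_of% (hβ₀ F), reassoc_of% hφ, h₂]
        exact h₁)
    have h₁ : (C.mapHomologicalComplex _).map φ ≫ b G =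
        (C.mapHomologicalComplex _).map (φ ≫ β G) ≫ compChainMap s _ := by
      rw [Functor.map_comp, Category.assoc]
    have h₂ : b F ≫ (T.mapHomologicalComplex _).map χ =
        (C.mapHomologicalComplex _).map (β F ≫ (S.mapHomologicalComplex _).map χ) ≫
          compChainMap s _ := by
      rw [Functor.map_comp, Category.assoc, Category.assoc, compChainMap_naturality]
    rw [h₁, h₂]
    exact ⟨(C.mapHomotopy h).compRight _⟩
  let H := HomologicalComplex.homologyFunctor 𝒟 (ComplexShape.down ℕ) p
  have hH {K L : ChainComplex 𝒟 ℕ} {f g : K ⟶ L} (h : Nonempty (Homotopy f g)) :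
      H.map f = H.map g := h.some.homologyMap_eq p
  let e (F : 𝒜) : H.obj ((C.mapHomologicalComplex _).obj (P F).complex) ≅
      H.obj ((T.mapHomologicalComplex _).obj (Q F).complex) :=
    { hom := H.map (b F)
      inv := H.map (a F)
      hom_inv_id := by rw [← H.map_comp, hH (hba F), H.map_id]
      inv_hom_id := by rw [← H.map_comp, hH (hab F), H.map_id] }
  refine ⟨NatIso.ofComponents (fun F => (P F).isoLeftDerivedObj C p ≪≫ e F ≪≫
    ((Q F).isoLeftDerivedObj T p).symm) fun {F G} f => ?_⟩
  let φ := ProjectiveResolution.lift f (P F) (P G)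
  let χ := ProjectiveResolution.lift (E.map f) (Q F) (Q G)
  have hφ : φ.f 0 ≫ (P G).π.f 0 = (P F).π.f 0 ≫ f :=
    ProjectiveResolution.lift_commutes_zero f (P F) (P G)
  have hχ : χ.f 0 ≫ (Q G).π.f 0 = (Q F).π.f 0 ≫ E.map f :=
    ProjectiveResolution.lift_commutes_zero (E.map f) (Q F) (Q G)
  have h₁ := (P F).isoLeftDerivedObj_hom_naturality f (P G) φ hφ C p
  have h₂ := (Q F).isoLeftDerivedObj_inv_naturality (E.map f) (Q G) χ hχ T p
  have h₃ : H.map ((C.mapHomologicalComplex _).map φ) ≫ H.map (b G) =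
      H.map (b F) ≫ H.map ((T.mapHomologicalComplex _).map χ) :=
    (H.map_comp _ _).symm.trans ((hH (hnat f φ hφ χ hχ)).trans (H.map_comp _ _))
  have h₄ : (C.leftDerived p).map f ≫ ((P G).isoLeftDerivedObj C p).hom =
      ((P F).isoLeftDerivedObj C p).hom ≫ H.map ((C.mapHomologicalComplex _).map φ) := h₁
  have h₅ : ((Q F).isoLeftDerivedObj T p).inv ≫ (T.leftDerived p).map (E.map f) =
      H.map ((T.mapHomologicalComplex _).map χ) ≫ ((Q G).isoLeftDerivedObj T p).inv := h₂
  change _ ≫ ((P G).isoLeftDerivedObj C p).hom ≫ H.map (b G) ≫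
      ((Q G).isoLeftDerivedObj T p).inv = (((P F).isoLeftDerivedObj C p).hom ≫ H.map (b F) ≫
      ((Q F).isoLeftDerivedObj T p).inv) ≫ (T.leftDerived p).map (E.map f)
  rw [reassoc_of% h₄, reassoc_of% h₃, Category.assoc, Category.assoc, h₅]

end Linked

/-! ### Modules over `ℤ[M]` -/

/-- The inclusion of `M` into `ℤ[M]`. -/
abbrev single : M →* ZM := MonoidAlgebra.of ℤ M

lemma map_smul_of_map_single_smul {V W : Type*} [AddCommGroup V] [Module ZM V] [AddCommGroup W]
    [Module ZM W] (g : V →+ W) (ψ : ZM →+* ZM)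
    (h : ∀ (f : M) (v : V), g (single f • v) = ψ (single f) • g v) (r : ZM) (v : V) :
    g (r • v) = ψ r • g v := by
  induction r using MonoidAlgebra.induction_on with
  | of f => exact h f v
  | add a b ha hb => rw [add_smul, map_add, ha, hb, map_add, add_smul]
  | smul k a ha => rw [smul_assoc, map_zsmul, ha, map_zsmul, smul_assoc]

lemma augmentation_single (f : M) : augmentation (single f) = 1 := by
  simp [augmentation]

section Coinvariants

open scoped TensorProduct

variable {V : Type u} [AddCommGroup V] {A : Type*} [AddCommGroup A]

/-- The map `ℤ ⊗_ℤ V → A` induced by a map `V → A`. -/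
def intTensorLift (g : V →+ A) : TrivialInt ⊗[ℤ] V →+ A :=
  (TensorProduct.lift (AddMonoidHom.toIntLinearMap (M := TrivialInt)
    (zmultiplesHom (V →ₗ[ℤ] A) g.toIntLinearMap))).toAddMonoidHom

lemma intTensorLift_tmul (g : V →+ A) (z : TrivialInt) (v : V) :
    intTensorLift g (z ⊗ₜ[ℤ] v) = (id (α := ℤ) z) • g v := rfl

variable [Module ZM V]

/-- The integer `1`, as an element of the trivial module. -/
def trivialOne : TrivialInt := (1 : ℤ)

/-- The element `1 ⊗ v` of `ℤ ⊗_{ℤ[M]} V`. -/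
def oneTensor : V →+ BalancedTensor ZM TrivialInt V :=
  (QuotientAddGroup.mk' _).comp
    (TensorProduct.mk ℤ TrivialInt V trivialOne).toAddMonoidHom

lemma oneTensor_single_smul (f : M) (v : V) : oneTensor (single f • v) = oneTensor v := by
  refine ((QuotientAddGroup.eq_iff_sub_mem (N := balancedRel ZM TrivialInt V)).2
    (AddSubgroup.subset_closure ⟨trivialOne, single f, v, ?_⟩)).symm
  rw [op_of_smul_trivialInt]
  rfl

lemma balancedTensor_hom_ext {g h : BalancedTensor ZM TrivialInt V →+ A}
    (H : ∀ v, g (oneTensor v) = h (oneTensor v)) : g = h := by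
  refine BalancedTensor.hom_ext fun n v => ?_
  have : (QuotientAddGroup.mk (n ⊗ₜ[ℤ] v) : BalancedTensor ZM TrivialInt V) =
      oneTensor ((id (α := ℤ) n) • v) := by
    refine congrArg QuotientAddGroup.mk ?_
    change n ⊗ₜ[ℤ] v = trivialOne ⊗ₜ[ℤ] ((id (α := ℤ) n) • v)
    rw [← TensorProduct.smul_tmul]
    congr 1
    exact (mul_one (id (α := ℤ) n)).symm
  rw [this, H]

/-- The map `ℤ ⊗_{ℤ[M]} V → A` induced by an `M`-invariant map `V → A`. -/
def balancedLift (g : V →+ A) (hg : ∀ (f : M) v, g (single f • v) = g v) :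
    BalancedTensor ZM TrivialInt V →+ A :=
  QuotientAddGroup.lift _
    (intTensorLift g) <| by
    rw [balancedRel, AddSubgroup.closure_le]
    rintro _ ⟨n, r, v, rfl⟩
    have h (r : ZM) : g (r • v) = augmentation r • g v := by
      induction r using MonoidAlgebra.induction_on with
      | of f => rw [hg, augmentation_single, one_smul]
      | add a b ha hb => rw [add_smul, map_add, ha, hb, map_add, add_smul]
      | smul k a ha => rw [smul_assoc, map_zsmul, ha, map_zsmul, smul_assoc]
    refine AddMonoidHom.mem_ker.2 ?_
    rw [map_sub, intTensorLift_tmul, intTensorLift_tmul]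
    change (augmentation r * id (α := ℤ) n : ℤ) • g v - (id (α := ℤ) n) • g (r • v) = 0
    rw [h, smul_smul, mul_comm, sub_self]

lemma balancedLift_oneTensor (g : V →+ A) (hg : ∀ (f : M) v, g (single f • v) = g v) (v : V) :
    balancedLift g hg (oneTensor v) = g v :=
  one_smul ℤ (g v)

end Coinvariants

/-! ### Injections of `ω` -/

/-- A morphism of `I` as an injection. -/
def toEmb {n m : I} (f : n ⟶ m) : Fin n.card ↪ Fin m.card := f

/-- The injection `𝐧 ⊔ ω → 𝐦 ⊔ ω` that extends `f : 𝐧 → 𝐦` by the identity, where `𝐧 ⊔ ω` is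
identified with `ω` by concatenation. -/
def extend {n m : I} (f : n ⟶ m) : M :=
  ⟨fun i => if h : i < n.card then (toEmb f ⟨i, h⟩ : ℕ)
    else m.card + (i - n.card), fun i j hij => by
      have hf (k : Fin n.card) := (toEmb f k).2
      dsimp only at hij
      split_ifs at hij with hi hj hj
      · simpa using (toEmb f).injective (Fin.ext hij)
      · have := hf ⟨i, hi⟩; omega
      · have := hf ⟨j, hj⟩; omega
      · omega⟩

lemma extend_of_lt {n m : I} (f : n ⟶ m) {i : ℕ} (h : i < n.card) :
    (extend f).1 i = (toEmb f ⟨i, h⟩ : ℕ) := dif_pos h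

lemma extend_of_le {n m : I} (f : n ⟶ m) {i : ℕ} (h : n.card ≤ i) :
    (extend f).1 i = m.card + (i - n.card) := dif_neg h.not_gt

lemma M_ext {f g : M} (h : ∀ i, f.1 i = g.1 i) : f = g := Subtype.ext (funext h)

lemma extend_id (n : I) : extend (𝟙 n) = 1 := M_ext fun i => by
  rcases lt_or_ge i n.card with h | h
  · exact extend_of_lt _ h
  · rw [extend_of_le _ h]
    exact Nat.add_sub_of_le h

lemma extend_comp {n m k : I} (f : n ⟶ m) (g : m ⟶ k) :
    extend (f ≫ g) = extend g * extend f := M_ext fun i => by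
  rw [M_mul_apply]
  rcases lt_or_ge i n.card with h | h
  · rw [extend_of_lt _ h, extend_of_lt f h, extend_of_lt g (Fin.is_lt _)]
    rfl
  · rw [extend_of_le _ h, extend_of_le f h, extend_of_le g (Nat.le_add_right _ _)]
    omega

/-- The doubling map `ω → ω ⊔ ω`, the inclusion of the first summand, where `ω ⊔ ω` is identified
with `ω` by interleaving. -/
def double : M := ⟨fun i => 2 * i, fun i j h => by dsimp only at h; omega⟩

/-- The map `f ⊔ id` of `ω ⊔ ω`, where `ω ⊔ ω` is identified with `ω` by interleaving. -/
def sumId (f : M) : M :=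
  ⟨fun i => if i % 2 = 0 then 2 * f.1 (i / 2) else i, fun i j h => by
    dsimp only at h
    split_ifs at h
    · have := f.2 (show f.1 (i / 2) = f.1 (j / 2) by omega)
      omega
    all_goals omega⟩

/-- The map `𝐧 ⊔ ω → ω ⊔ ω` given by the inclusion of `𝐧` into `ω`. -/
def interleave (n : ℕ) : M :=
  ⟨fun i => if i < n then 2 * i else 2 * (i - n) + 1, fun i j h => by
    dsimp only at h
    split_ifs at h <;> omega⟩

lemma sumId_even (f : M) (i : ℕ) : (sumId f).1 (2 * i) = 2 * f.1 i := by
  simp [sumId]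

lemma sumId_odd (f : M) (i : ℕ) : (sumId f).1 (2 * i + 1) = 2 * i + 1 :=
  if_neg (by omega)

lemma interleave_of_lt {n i : ℕ} (h : i < n) : (interleave n).1 i = 2 * i := if_pos h

lemma interleave_of_le {n i : ℕ} (h : n ≤ i) : (interleave n).1 i = 2 * (i - n) + 1 :=
  if_neg h.not_gt

/-- `f ↦ f ⊔ id` as an endomorphism of `M`. -/
def sumIdHom : M →* M where
  toFun := sumId
  map_one' := M_ext fun i => by
    rcases Nat.even_or_odd' i with ⟨k, rfl | rfl⟩
    · exact sumId_even 1 k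
    · exact sumId_odd 1 k
  map_mul' f g := M_ext fun i => by
    rw [M_mul_apply]
    rcases Nat.even_or_odd' i with ⟨k, rfl | rfl⟩
    · rw [sumId_even, sumId_even, sumId_even, M_mul_apply]
    · rw [sumId_odd, sumId_odd, sumId_odd]

lemma double_mul (f : M) : double * f = sumId f * double :=
  M_ext fun i => (sumId_even f i).symm

lemma interleave_mul_extend (f : M) {n m : ℕ} (h : ∀ i < n, f.1 i < m) :
    interleave m * extend (restrict f h) = sumId f * interleave n := M_ext fun i => by
  rw [M_mul_apply, M_mul_apply]
  rcases lt_or_ge i n with hi | hi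
  · rw [extend_of_lt _ hi, interleave_of_lt hi, sumId_even]
    exact interleave_of_lt (h i hi)
  · rw [extend_of_le _ hi, interleave_of_le hi, sumId_odd,
      interleave_of_le (Nat.le_add_right m (i - n))]
    omega

lemma interleave_mul_extend_inclusion {n m : ℕ} (h : n ⟶ m) :
    interleave m * extend (inclusion.map h) = interleave n := M_ext fun i => by
  have := leOfHom h
  rw [M_mul_apply]
  rcases lt_or_ge i n with hi | hi
  · rw [extend_of_lt _ hi, interleave_of_lt hi]
    exact interleave_of_lt (hi.trans_le this)
  · rw [extend_of_le _ hi, interleave_of_le hi, interleave_of_le (Nat.le_add_right m (i - n))]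
    change 2 * (m + (i - n) - m) + 1 = _
    omega

/-! ### The functors -/

/-- The `I`-functor with constant value `V`, on which an injection `f` acts through `f ⊔ id_ω`. -/
def extendObj (V : ModuleCat.{u} ZM) : I ⥤ AddCommGrpCat.{u} where
  obj _ := AddCommGrpCat.of V
  map f := AddCommGrpCat.ofHom (DistribSMul.toAddMonoidHom V (single (extend f)))
  map_id n := by
    ext v
    change single (extend (𝟙 n)) • v = v
    rw [extend_id, map_one, one_smul]
  map_comp f g := by
    ext v
    change single (extend (f ≫ g)) • v = single (extend g) • single (extend f) • v
    rw [extend_comp, map_mul, mul_smul]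

/-- The functor from `ℤ[M]`-modules to `I`-functors given by `extendObj`. -/
def extendFunctor : ModuleCat.{u} ZM ⥤ (I ⥤ AddCommGrpCat.{u}) where
  obj := extendObj
  map {V W} φ :=
    { app := fun _ => (forget₂ (ModuleCat.{u} ZM) AddCommGrpCat.{u}).map φ
      naturality := fun n m f => by
        ext v
        exact φ.hom.map_smul (single (extend f)) v }

instance : (extendFunctor.{u}).Additive where

instance : PreservesFiniteLimits extendFunctor.{u} where
  preservesFiniteLimits J _ _ := preservesLimitsOfShape_of_evaluation _ _ fun _ =>
    inferInstanceAs (PreservesLimitsOfShape J (forget₂ (ModuleCat.{u} ZM) AddCommGrpCat.{u}))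

instance : PreservesFiniteColimits extendFunctor.{u} where
  preservesFiniteColimits J _ _ := preservesColimitsOfShape_of_evaluation _ _ fun _ =>
    inferInstanceAs (PreservesColimitsOfShape J (forget₂ (ModuleCat.{u} ZM) AddCommGrpCat.{u}))

/-- The endomorphism of `ℤ[M]` given by `f ↦ f ⊔ id`. -/
abbrev sumIdRing : ZM →+* ZM := MonoidAlgebra.mapDomainRingHom ℤ sumIdHom

lemma sumIdRing_single (f : M) : sumIdRing (single f) = single (sumId f) := by
  simp [sumIdRing, sumIdHom]

/-- The restriction of modules along `f ↦ f ⊔ id`. -/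
abbrev sumIdFunctor : ModuleCat.{u} ZM ⥤ ModuleCat.{u} ZM := ModuleCat.restrictScalars sumIdRing

instance : PreservesFiniteLimits sumIdFunctor.{u} :=
  have : PreservesFiniteLimits (sumIdFunctor.{u} ⋙ forget₂ _ AddCommGrpCat.{u}) :=
    inferInstanceAs (PreservesFiniteLimits (forget₂ (ModuleCat.{u} ZM) AddCommGrpCat.{u}))
  preservesFiniteLimits_of_reflects_of_preserves _ (forget₂ _ AddCommGrpCat.{u})

instance : PreservesFiniteColimits sumIdFunctor.{u} :=
  have : PreservesFiniteColimits (sumIdFunctor.{u} ⋙ forget₂ _ AddCommGrpCat.{u}) :=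
    inferInstanceAs (PreservesFiniteColimits (forget₂ (ModuleCat.{u} ZM) AddCommGrpCat.{u}))
  preservesFiniteColimits_of_reflects_of_preserves _ (forget₂ _ AddCommGrpCat.{u})

instance : (colimNat.{u}).Additive where
  map_add := (forget₂ (ModuleCat.{u} ZM) AddCommGrpCat.{u}).map_injective <|
    ((Functor.whiskeringLeft ℕ I AddCommGrpCat.{u}).obj inclusion ⋙ colim).map_add

instance : HasExactColimitsOfShape ℕ AddCommGrpCat.{u} :=
  .of_domain_equivalence _ (AsSmall.equiv.{0, 0, u} (C := ℕ)).symm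

instance : PreservesFiniteLimits colimNat.{u} :=
  have : PreservesFiniteLimits (colimNat.{u} ⋙ forget₂ _ AddCommGrpCat.{u}) :=
    comp_preservesFiniteLimits ((Functor.whiskeringLeft ℕ I AddCommGrpCat.{u}).obj inclusion) colim
  preservesFiniteLimits_of_reflects_of_preserves _ (forget₂ _ AddCommGrpCat.{u})

instance : PreservesFiniteColimits colimNat.{u} :=
  have : PreservesFiniteColimits (colimNat.{u} ⋙ forget₂ _ AddCommGrpCat.{u}) :=
    comp_preservesFiniteColimits ((Functor.whiskeringLeft ℕ I AddCommGrpCat.{u}).obj inclusion)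
      colim
  preservesFiniteColimits_of_reflects_of_preserves _ (forget₂ _ AddCommGrpCat.{u})

/-! ### Elements of `colim_ℕ F` -/

section Elements

variable (F : I ⥤ AddCommGrpCat.{u})

/-- The class in `colim_ℕ F` of an element of `F(𝐧)`. -/
def cls (n : ℕ) : F.obj ⟨n⟩ →+ colimModule F := (omegaι F n).hom

variable {F}

lemma single_smul_cls (f : M) {n m : ℕ} (h : ∀ i < n, f.1 i < m) (x : F.obj ⟨n⟩) :
    single f • cls F n x = cls F m (F.map (restrict f h) x) := by
  have h₁ : omegaRingHom F (single f) = omegaMap F f := by simp [omegaRingHom, omegaAction]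
  change (show omegaColim F ⟶ omegaColim F from omegaRingHom F (single f)) (omegaι F n x) = _
  rw [h₁]
  exact ConcreteCategory.congr_hom (ι_omegaMap F f h) x

lemma colimNat_map_cls {G : I ⥤ AddCommGrpCat.{u}} (φ : F ⟶ G) (n : ℕ) (x : F.obj ⟨n⟩) :
    (colimNat.map φ).hom (cls F n x) = cls G n (φ.app ⟨n⟩ x) :=
  ConcreteCategory.congr_hom (ι_colimMap (Functor.whiskerLeft inclusion φ) n) x

lemma colimModule_hom_ext {A : Type u} [AddCommGroup A] {g h : colimModule F →+ A}
    (H : ∀ n x, g (cls F n x) = h (cls F n x)) : g = h := by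
  have : (AddCommGrpCat.ofHom g : omegaColim F ⟶ AddCommGrpCat.of A) = AddCommGrpCat.ofHom h :=
    colimit.hom_ext fun n => by
      ext x
      exact H n x
  exact congrArg AddCommGrpCat.Hom.hom this

/-- The cocone over `F` restricted to `ℕ` given by compatible maps out of the groups `F(𝐧)`. -/
def omegaCocone {A : Type u} [AddCommGroup A] (g : ∀ n, F.obj ⟨n⟩ →+ A)
    (hg : ∀ {n m : ℕ} (h : n ⟶ m) x, g m (F.map (inclusion.map h) x) = g n x) :
    Cocone (inclusion ⋙ F) where
  pt := AddCommGrpCat.of A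
  ι :=
    { app := fun n => AddCommGrpCat.ofHom (g n)
      naturality := fun n m h => by
        ext x
        exact hg h x }

/-- The map out of `colim_ℕ F` given by compatible maps out of the groups `F(𝐧)`. -/
def colimModuleDesc {A : Type u} [AddCommGroup A] (g : ∀ n, F.obj ⟨n⟩ →+ A)
    (hg : ∀ {n m : ℕ} (h : n ⟶ m) x, g m (F.map (inclusion.map h) x) = g n x) :
    colimModule F →+ A :=
  (colimit.desc (inclusion ⋙ F) (omegaCocone g hg)).hom

lemma colimModuleDesc_cls {A : Type u} [AddCommGroup A] (g : ∀ n, F.obj ⟨n⟩ →+ A)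
    (hg : ∀ {n m : ℕ} (h : n ⟶ m) x, g m (F.map (inclusion.map h) x) = g n x) (n : ℕ)
    (x : F.obj ⟨n⟩) : colimModuleDesc g hg (cls F n x) = g n x :=
  ConcreteCategory.congr_hom (colimit.ι_desc (omegaCocone g hg) n) x

end Elements

lemma tensorFunctor_hom_ext {V : ModuleCat.{u} ZM} {A : AddCommGrpCat.{u}}
    {g h : (tensorFunctor.{0, u} ZM TrivialInt).obj V ⟶ A}
    (H : ∀ v : V, g.hom (oneTensor v) = h.hom (oneTensor v)) : g = h :=
  AddCommGrpCat.hom_ext (balancedTensor_hom_ext H)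

lemma tensorFunctor_map_oneTensor {V W : ModuleCat.{u} ZM} (φ : V ⟶ W) (v : V) :
    ((tensorFunctor.{0, u} ZM TrivialInt).map φ).hom (oneTensor v) = oneTensor (φ.hom v) := rfl

/-! ### The natural transformations -/

/-- A map of modules `V ⟶ W`, where `M` acts on `W` through `f ↦ f ⊔ id`. -/
def toSumId {V W : ModuleCat.{u} ZM} (g : V →+ W)
    (hg : ∀ (f : M) v, g (single f • v) = single (sumId f) • g v) :
    V ⟶ sumIdFunctor.obj W :=
  ModuleCat.ofHom (Y := sumIdFunctor.obj W)
    { toFun := g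
      map_add' := g.map_add
      map_smul' := map_smul_of_map_single_smul g sumIdRing fun f v => by
        rw [hg, sumIdRing_single] }

/-- The maps `F(𝐧) → colim_ℕ F`. -/
def toExtendColim : 𝟭 (I ⥤ AddCommGrpCat.{u}) ⟶ colimNat ⋙ extendFunctor where
  app F :=
    { app := fun n => AddCommGrpCat.ofHom (cls F n.card)
      naturality := fun n m f => by
        ext x
        have h : ∀ i < n.card, (extend f).1 i < m.card := fun i hi => by
          rw [extend_of_lt f hi]
          exact Fin.is_lt _
        have h' : restrict (extend f) h = f :=
          Function.Embedding.ext fun i => Fin.ext (extend_of_lt f i.2)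
        refine Eq.trans ?_ (single_smul_cls (extend f) h x).symm
        rw [h']
        rfl }
  naturality F G φ := by
    ext n x
    exact (colimNat_map_cls φ n.card x).symm

/-- The action of the doubling map. -/
def toSumIdFunctor : 𝟭 (ModuleCat.{u} ZM) ⟶ sumIdFunctor where
  app V := toSumId (DistribSMul.toAddMonoidHom V (single double)) fun f v => by
    change single double • single f • v = single (sumId f) • single double • v
    rw [smul_smul, smul_smul, ← map_mul, ← map_mul, double_mul]
  naturality V W φ := by
    ext v
    exact (φ.hom.map_smul (single double) v).symm

lemma interleave_smul_extendObj_map {V : ModuleCat.{u} ZM} {n m : ℕ} (h : n ⟶ m) (v : V) :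
    single (interleave m) • single (extend (inclusion.map h)) • v = single (interleave n) • v := by
  rw [smul_smul, ← map_mul, interleave_mul_extend_inclusion]

/-- The homomorphism `colim_n V → V` given by the maps `𝐧 ⊔ ω → ω ⊔ ω`. -/
def colimExtendHom (V : ModuleCat.{u} ZM) : colimModule (extendObj V) →+ V :=
  colimModuleDesc (F := extendObj V)
    (fun n => DistribSMul.toAddMonoidHom V (single (interleave n)))
    fun h (v : V) => interleave_smul_extendObj_map h v

lemma colimExtendHom_cls {V : ModuleCat.{u} ZM} (n : ℕ) (v : V) :
    colimExtendHom V (cls (extendObj V) n v) = single (interleave n) • v :=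
  colimModuleDesc_cls (F := extendObj V) _ (fun h (v : V) => interleave_smul_extendObj_map h v) n v

lemma colimExtendHom_smul {V : ModuleCat.{u} ZM} (f : M) (x : colimModule (extendObj V)) :
    colimExtendHom V (single f • x) = single (sumId f) • colimExtendHom V x := by
  have : (colimExtendHom V).comp (DistribSMul.toAddMonoidHom _ (single f)) =
      (DistribSMul.toAddMonoidHom V (single (sumId f))).comp (colimExtendHom V) :=
    colimModule_hom_ext fun n (v : V) => by
      refine (congrArg (colimExtendHom V)
        (single_smul_cls (F := extendObj V) f (lt_bound f n) v)).trans ?_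
      refine (colimExtendHom_cls (V := V) _ (single (extend (restrict f (lt_bound f n))) • v)).trans
        ?_
      refine Eq.trans ?_ (congrArg (single (sumId f) • ·) (colimExtendHom_cls n v)).symm
      rw [smul_smul, smul_smul, ← map_mul, ← map_mul, interleave_mul_extend]
  exact DFunLike.congr_fun this x

/-- The action of the maps `𝐧 ⊔ ω → ω ⊔ ω`. -/
def colimExtendTo : extendFunctor.{u} ⋙ colimNat ⟶ sumIdFunctor where
  app V := toSumId (V := colimModule (extendObj V)) (colimExtendHom V) colimExtendHom_smul
  naturality V W φ := by
    have : (colimExtendHom W).comp (colimNat.map (extendFunctor.map φ)).hom.toAddMonoidHom =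
        φ.hom.toAddMonoidHom.comp (colimExtendHom V) :=
      colimModule_hom_ext fun n (v : V) => by
        refine (congrArg (colimExtendHom W) (colimNat_map_cls (extendFunctor.map φ) n v)).trans ?_
        refine (colimExtendHom_cls n (φ.hom v)).trans ?_
        refine Eq.trans ?_ (congrArg φ.hom (colimExtendHom_cls n v)).symm
        exact (φ.hom.map_smul _ _).symm
    ext x
    exact DFunLike.congr_fun this x

lemma ι_map_inclusion (F : I ⥤ AddCommGrpCat.{u}) {n m : ℕ} (h : n ⟶ m) (x : F.obj ⟨n⟩) :
    (colimit.ι F ⟨m⟩).hom (F.map (inclusion.map h) x) = (colimit.ι F ⟨n⟩).hom x :=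
  ConcreteCategory.congr_hom (colimit.w F (inclusion.map h)) x

/-- The map `colim_ℕ F → colim_I F`. -/
def colimNatHom (F : I ⥤ AddCommGrpCat.{u}) : colimModule F →+ (colimit F : AddCommGrpCat.{u}) :=
  colimModuleDesc (fun n => (colimit.ι F ⟨n⟩).hom) (ι_map_inclusion F)

lemma colimNatHom_cls {F : I ⥤ AddCommGrpCat.{u}} (n : ℕ) (x : F.obj ⟨n⟩) :
    colimNatHom F (cls F n x) = (colimit.ι F ⟨n⟩).hom x :=
  colimModuleDesc_cls _ (ι_map_inclusion F) n x

lemma colimNatHom_smul {F : I ⥤ AddCommGrpCat.{u}} (f : M) (x : colimModule F) :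
    colimNatHom F (single f • x) = colimNatHom F x := by
  have : (colimNatHom F).comp (DistribSMul.toAddMonoidHom _ (single f)) = colimNatHom F :=
    colimModule_hom_ext fun n x => by
      change colimNatHom F (single f • cls F n x) = _
      rw [single_smul_cls f (lt_bound f n), colimNatHom_cls, colimNatHom_cls]
      exact ConcreteCategory.congr_hom (colimit.w F (restrict f (lt_bound f n))) x
  exact DFunLike.congr_fun this x

/-- The map `ℤ ⊗_{ℤ[M]} colim_ℕ F → colim_I F`. -/
def tensorColimTo : colimNat.{u} ⋙ tensorFunctor.{0, u} ZM TrivialInt ⟶ colim where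
  app F := AddCommGrpCat.ofHom (balancedLift (colimNatHom F) colimNatHom_smul)
  naturality F G φ := by
    have : (colimNatHom G).comp (colimNat.map φ).hom.toAddMonoidHom =
        (colim.map φ).hom.comp (colimNatHom F) :=
      colimModule_hom_ext fun n x => by
        refine (congrArg (colimNatHom G) (colimNat_map_cls φ n x)).trans ?_
        refine (colimNatHom_cls n _).trans ?_
        refine Eq.trans ?_ (congrArg (colim.map φ).hom (colimNatHom_cls n x)).symm
        exact (ConcreteCategory.congr_hom (ι_colimMap φ ⟨n⟩) x).symm
    refine tensorFunctor_hom_ext fun v => ?_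
    refine (balancedLift_oneTensor _ colimNatHom_smul ((colimNat.map φ).hom v)).trans ?_
    refine Eq.trans (DFunLike.congr_fun this v) ?_
    exact congrArg (colim.map φ).hom (balancedLift_oneTensor _ colimNatHom_smul v).symm

/-- The cocone of the maps `v ↦ 1 ⊗ v`. -/
def oneTensorCocone (V : ModuleCat.{u} ZM) : Cocone (extendObj V) where
  pt := AddCommGrpCat.of (BalancedTensor ZM TrivialInt V)
  ι :=
    { app := fun n => AddCommGrpCat.ofHom oneTensor
      naturality := fun n m f => by
        ext v
        exact oneTensor_single_smul (V := V) (extend f) v }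

lemma desc_oneTensorCocone {V : ModuleCat.{u} ZM} (n : I) (v : V) :
    (colimit.desc (extendObj V) (oneTensorCocone V)).hom ((colimit.ι (extendObj V) n).hom v) =
      oneTensor v :=
  ConcreteCategory.congr_hom (colimit.ι_desc (oneTensorCocone V) n) v

/-- The map from the colimit of `extendObj V` to `ℤ ⊗_{ℤ[M]} V`. -/
def colimExtendToTensor : extendFunctor.{u} ⋙ colim ⟶ tensorFunctor.{0, u} ZM TrivialInt where
  app V := colimit.desc (extendObj V) (oneTensorCocone V)
  naturality V W φ := by
    refine colimit.hom_ext fun n => ?_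
    ext v
    refine (congrArg (colimit.desc (extendObj W) (oneTensorCocone W)).hom
      (ConcreteCategory.congr_hom (ι_colimMap (extendFunctor.map φ) n) v)).trans ?_
    refine (desc_oneTensorCocone n (φ.hom v)).trans ?_
    exact (congrArg ((tensorFunctor.{0, u} ZM TrivialInt).map φ).hom
      (desc_oneTensorCocone n v)).symm

lemma oneTensor_sumId_smul (V : ModuleCat.{u} ZM) (f : M) (v : sumIdFunctor.obj V) :
    oneTensor (V := V) (single f • v) = oneTensor (V := V) v := by
  have : single f • v = single (sumId f) • (show V from v) :=
    congrArg (fun r : ZM => r • (show V from v)) (sumIdRing_single f)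
  rw [this, oneTensor_single_smul]

/-- The map `ℤ ⊗_{ℤ[M]} V → ℤ ⊗_{ℤ[M]} V` that is the identity of `V`, where `M` acts on the
first module `V` through `f ↦ f ⊔ id`. -/
def sumIdTensorHom (V : ModuleCat.{u} ZM) :
    BalancedTensor ZM TrivialInt (sumIdFunctor.obj V) →+ BalancedTensor ZM TrivialInt V :=
  balancedLift (V := sumIdFunctor.obj V) (oneTensor (V := V)) (oneTensor_sumId_smul V)

lemma sumIdTensorHom_oneTensor {V : ModuleCat.{u} ZM} (v : V) :
    sumIdTensorHom V (oneTensor (V := sumIdFunctor.obj V) v) = oneTensor v :=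
  balancedLift_oneTensor (V := sumIdFunctor.obj V) _ (oneTensor_sumId_smul V) v

/-- The natural transformation given by `sumIdTensorHom`. -/
def sumIdTensorTo : sumIdFunctor.{u} ⋙ tensorFunctor.{0, u} ZM TrivialInt ⟶
    tensorFunctor.{0, u} ZM TrivialInt where
  app V := AddCommGrpCat.ofHom (sumIdTensorHom V)
  naturality V W φ := by
    have h (v : V) : sumIdTensorHom W (oneTensor (V := sumIdFunctor.obj W) (φ.hom v)) =
        ((tensorFunctor.{0, u} ZM TrivialInt).map φ).hom (sumIdTensorHom V
          (oneTensor (V := sumIdFunctor.obj V) v)) := by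
      rw [sumIdTensorHom_oneTensor, sumIdTensorHom_oneTensor, tensorFunctor_map_oneTensor]
    refine tensorFunctor_hom_ext (V := sumIdFunctor.obj V) fun v => ?_
    exact h v

end DerivedColim

end

theorem mainTheorem3 (p : ℕ) :
    Nonempty
      ((colim : (DerivedColim.I ⥤ AddCommGrpCat.{u}) ⥤ AddCommGrpCat.{u}).leftDerived p ≅
        DerivedColim.colimNat.{u} ⋙
          DerivedColim.torFunctor.{0, u} DerivedColim.ZM DerivedColim.TrivialInt p) := by
  open DerivedColim in
  refine DerivedColim.nonempty_leftDerived_iso DerivedColim.toExtendColim.{u}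
    DerivedColim.toSumIdFunctor.{u} DerivedColim.colimExtendTo.{u} DerivedColim.tensorColimTo.{u}
    DerivedColim.colimExtendToTensor.{u} DerivedColim.sumIdTensorTo.{u} ?_ ?_ ?_ ?_ p
  · intro F
    refine colimit.hom_ext fun n => ?_
    ext x
    have h₁ : (colim.map (toExtendColim.app F)).hom ((colimit.ι F n).hom x) =
        (colimit.ι (extendObj (colimModule F)) n).hom (cls F n.card x) :=
      ConcreteCategory.congr_hom (ι_colimMap (toExtendColim.app F) n) x
    refine (congrArg (fun y => (tensorColimTo.app F).hom
      ((colimExtendToTensor.app (colimModule F)).hom y)) h₁).trans ?_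
    refine (congrArg (tensorColimTo.app F).hom
      (desc_oneTensorCocone (V := colimModule F) n (cls F n.card x))).trans ?_
    refine (balancedLift_oneTensor _ colimNatHom_smul (cls F n.card x)).trans ?_
    exact colimNatHom_cls n.card x
  · intro V
    refine tensorFunctor_hom_ext fun v => ?_
    refine (sumIdTensorHom_oneTensor (single double • v : V)).trans ?_
    exact oneTensor_single_smul _ _
  · intro F
    have : (colimExtendHom (colimModule F)).comp
          (colimNat.map (toExtendColim.app F)).hom.toAddMonoidHom =
        DistribSMul.toAddMonoidHom (colimModule F) (single double) :=
      colimModule_hom_ext fun n x => by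
        refine (congrArg (colimExtendHom (colimModule F))
          (colimNat_map_cls (toExtendColim.app F) n x)).trans ?_
        refine (colimExtendHom_cls (V := colimModule F) n (cls F n x)).trans ?_
        have h : ∀ i < n, double.1 i < 2 * n := fun i hi => by
          change 2 * i < 2 * n
          omega
        have h' : ∀ i < n, (interleave n).1 i < 2 * n := fun i hi => by
          rw [interleave_of_lt hi]
          omega
        have e : restrict (interleave n) h' = restrict double h :=
          Function.Embedding.ext fun i => Fin.ext (interleave_of_lt i.2)
        refine (single_smul_cls _ h' x).trans ?_
        rw [e]
        exact (single_smul_cls _ h x).symm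
    ext x
    exact DFunLike.congr_fun this x
  · intro V
    refine tensorFunctor_hom_ext fun x => ?_
    have h₁ : (tensorColimTo.app (extendFunctor.obj V)).hom (oneTensor x) =
        colimNatHom (extendObj V) x := balancedLift_oneTensor _ colimNatHom_smul x
    refine (congrArg (colimExtendToTensor.app V).hom h₁).trans ?_
    refine Eq.trans ?_ (sumIdTensorHom_oneTensor (colimExtendHom V x)).symm
    have : (colimExtendToTensor.app V).hom.comp (colimNatHom (extendObj V)) =
        oneTensor.comp (colimExtendHom V) :=
      colimModule_hom_ext fun n (v : V) => by
        refine (congrArg (colimExtendToTensor.app V).hom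
          (colimNatHom_cls (F := extendObj V) n v)).trans ?_
        refine (desc_oneTensorCocone ⟨n⟩ v).trans ?_
        refine Eq.trans ?_ (congrArg oneTensor (colimExtendHom_cls n v)).symm
        exact (oneTensor_single_smul (interleave n) v).symm
    exact DFunLike.congr_fun this x
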